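/- **Theorem 1.** Let $q\ge 1$ and $T\ge q+3$ be integers. An *earnings dynamics structure* consists of real coefficients $a=(a_1,\dots,a_q)$ and real random variables $\xi_{1-q},\dots,\xi_T,\eta_1,\dots,\eta_T$ on a probability space such that $\xi_{1-q},\dots,\xi_0,(\xi_1,\eta_1),\dots,(\xi_T,\eta_T)$ are mutually independent; within a pair $(\xi_t,\eta_t)$ the dependence is arbitrary, and no moments are assumed to exist. It generates the observed earnings $$y_t=v_t+w_t,\qquad v_t=\eta_1+\dots+\eta_t,\qquad w_t=\xi_t+a_1\xi_{t-1}+\dots+a_q\xi_{t-q}\qquad(t=1,\dots,T).$$ Let $(a,\xi,\eta)$ be an earnings dynamics structure with $a_1\notin\{0,1\}$ and $a_q\notin\{0,1\}$ for which $\xi_1$ is nongaussian, that is, $\xi_1$ is neither normally distributed nor almost surely constant. Then $a_1,\dots,a_q$ are identified from the distribution of $(y_1,\dots,y_T)$: if $(\tilde a,\tilde\xi,\tilde\eta)$ is any earnings dynamics structure with the same $q$ and $T$, possibly on a different probability space, with $\tilde a_q\neq 0$, and if the vector $(\tilde y_1,\dots,\tilde y_T)$ it generates has the same distribution as $(y_1,\dots,y_T)$,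 then $\tilde a_j=a_j$ for all $j=1,\dots,q$. -/

import Mathlib

open MeasureTheory ProbabilityTheory

namespace EarningsDynamics

variable {Ω : Type*}

/-- The permanent income component, a random walk: `v t = η 1 + ... + η t`. -/
noncomputable def permanent (η : ℤ → Ω → ℝ) (t : ℤ) (ω : Ω) : ℝ :=
  ∑ s ∈ Finset.Icc (1 : ℤ) t, η s ω

/-- The transitory income component, a moving average of order `q`:
`w t = ξ t + a_1 * ξ (t - 1) + ... + a_q * ξ (t - q)`.
The coefficient `a_j` is the entry of `a : Fin q → ℝ` at position `j - 1`. -/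
def transitory {q : ℕ} (a : Fin q → ℝ) (ξ : ℤ → Ω → ℝ) (t : ℤ) (ω : Ω) : ℝ :=
  ξ t ω + ∑ j : Fin q, a j * ξ (t - ((j : ℤ) + 1)) ω

/-- The vector `(y 1, ..., y T)` of observed earnings, `y t = v t + w t`.
The period `t` is at position `t - 1`. -/
noncomputable def earnings {q : ℕ} (T : ℕ) (a : Fin q → ℝ) (ξ η : ℤ → Ω → ℝ) (ω : Ω) : Fin T → ℝ :=
  fun t => permanent η ((t : ℤ) + 1) ω + transitory a ξ ((t : ℤ) + 1) ω

/-- The shocks of period `s`: the pair `(ξ s, η s)` if `1 ≤ s`, and `ξ s` alone (completed by the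
constant `0`, which carries no information) in the pre-sample periods `s ≤ 0`. -/
def shocks (ξ η : ℤ → Ω → ℝ) (s : ℤ) (ω : Ω) : ℝ × ℝ :=
  (ξ s ω, if 1 ≤ s then η s ω else 0)

/-- The assumption on the shocks of an earnings dynamics model of order `q` with `T` periods:
`ξ (1 - q), ..., ξ T` and `η 1, ..., η T` are random variables, and
`ξ (1 - q), ..., ξ 0, (ξ 1, η 1), ..., (ξ T, η T)` are mutually independent.
The values of `ξ` and `η` at all other indices are irrelevant. -/
structure ShockAssumption [MeasurableSpace Ω] (P : Measure Ω) (q T : ℕ)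
    (ξ η : ℤ → Ω → ℝ) : Prop where
  measurable_transitory : ∀ s ∈ Finset.Icc (1 - (q : ℤ)) (T : ℤ), Measurable (ξ s)
  measurable_permanent : ∀ s ∈ Finset.Icc (1 : ℤ) (T : ℤ), Measurable (η s)
  indep : iIndepFun (fun s : Finset.Icc (1 - (q : ℤ)) (T : ℤ) => shocks ξ η (s : ℤ)) P

end EarningsDynamics

/-! Suppose the two coefficient vectors differ. By independence, the characteristic function of the
earnings is a product over periods of joint characteristic functions of the shocks, so near the
origin the two structures have equal sums of logarithms (`eventually_sum_log_eq`). Along the first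
difference of earnings at date `i`, the shocks of period `s` have loading `β (i - s)` on `ξ s`, and
loading `1` on `η s` exactly when `i = s`; here `β` is the differenced lag polynomial, supported on
`0, ..., q + 1`. A difference of the sum along several directions keeps only the summands loaded on
all of them.

Over the lags `1, ..., q + 1` both `β` and `β'` sum to `-1`, so distinct coefficients are not
proportional there (`exists_minor_ne_zero`). Hence for `s = 1, 2` some direction is invisible to
period `s` in the second structure and moves `ξ s` alone in the first. Dates `2` and `q + 3` are
shared by period `2` only; together with that direction they annihilate a third difference of its
log characteristic function, and by symmetry that of the other structure. Dates `2` and `q + 2` are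
shared by periods `1` and `2` only, so period `1` is now isolated. Moving the base point along the
invisible direction makes the fourth differences of the log characteristic function of `ξ 1` vanish
near `0` (`eventually_fourthDiff_eq_zero`).

That function is therefore a cubic polynomial near `0`, and a local form of Marcinkiewicz's theorem
(`isGaussian_of_fourthDiff_log_charFun`) makes `ξ 1` Gaussian, a contradiction. -/

namespace EarningsDynamics

open Filter Topology

/-! ### Continuous functions with vanishing local differences are polynomials. -/

section LocalPolynomial

/-- A locally additive function that is continuous at `0` is locally linear. -/
lemma eq_mul_of_locally_additive {A : ℝ → ℂ} {r ρ : ℝ} (hρ : 0 < ρ) (hρr : ρ < r)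
    (hadd : ∀ x y, |x| < r → |y| < r → |x + y| < r → A (x + y) = A x + A y)
    (hc : ContinuousAt A 0) {x : ℝ} (hx : |x| ≤ ρ) : A x = (x / ρ : ℝ) * A ρ := by
  have hr : 0 < r := hρ.trans hρr
  have h0 : A 0 = 0 := by
    have := hadd 0 0 (by simpa) (by simpa) (by simpa)
    simpa using this
  have hneg : ∀ x, |x| < r → A (-x) = -A x := fun x hx ↦ by
    have := hadd x (-x) hx (by simpa) (by simpa)
    rw [add_neg_cancel, h0] at this
    linear_combination -this
  have hmul : ∀ (n : ℕ) (y : ℝ), 0 ≤ y → n * y < r → A (n * y) = n * A y := by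
    intro n y hy
    induction n with
    | zero => intro _; simp [h0]
    | succ n ih =>
      intro h
      push_cast at h ⊢
      have hny : 0 ≤ n * y := by positivity
      have h1 : n * y < r := by linarith
      have h2 : y < r := by linarith
      rw [add_mul, one_mul, hadd _ _ (by rwa [abs_of_nonneg hny]) (by rwa [abs_of_nonneg hy])
        (by rw [abs_of_nonneg (by positivity)]; linarith), ih h1]
      ring
  have key : ∀ x, 0 ≤ x → x ≤ ρ → A x = (x / ρ : ℝ) * A ρ := by
    intro x hx0 hxρ
    -- The remainder of `x` on the grid of mesh `ρ / (N + 1)`. The deviation from linearity is the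
    -- same at `x` and at this remainder, which tends to `0`, where continuity applies.
    let y : ℕ → ℝ := fun N ↦ x - ⌊(N + 1) * x / ρ⌋₊ * (ρ / (N + 1))
    have hy : ∀ N, 0 ≤ y N ∧ y N ≤ ρ / (N + 1) := by
      intro N
      have hN : (0 : ℝ) < N + 1 := by positivity
      have h1 := Nat.floor_le (show 0 ≤ (N + 1) * x / ρ by positivity)
      have h2 := Nat.lt_floor_add_one ((N + 1) * x / ρ)
      have h3 : x = ((N + 1) * x / ρ) * (ρ / (N + 1)) := by field_simp
      have h4 : 0 ≤ ρ / (N + 1) := by positivity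
      constructor
      · have := mul_le_mul_of_nonneg_right h1 h4
        simp only [y]; linarith
      · have := mul_le_mul_of_nonneg_right h2.le h4
        simp only [y]; linarith
    have hval : ∀ N, A x - (x / ρ : ℝ) * A ρ = A (y N) - (y N / ρ : ℝ) * A ρ := by
      intro N
      have hN : (0 : ℝ) < N + 1 := by positivity
      have e1 : A ρ = (N + 1) * A (ρ / (N + 1)) := by
        have := hmul (N + 1) (ρ / (N + 1)) (by positivity)
          (by push_cast; rwa [mul_div_cancel₀ _ hN.ne'])
        push_cast at this
        rwa [mul_div_cancel₀ _ hN.ne'] at this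
      set k := ⌊(N + 1) * x / ρ⌋₊ with hk
      have hkx : k * (ρ / (N + 1)) ≤ x := by
        have := (hy N).1; simp only [y] at this; linarith
      have e2 := hmul k (ρ / (N + 1)) (by positivity) (by linarith)
      have hk0 : 0 ≤ k * (ρ / (N + 1)) := by positivity
      have hyx : y N ≤ x := by simp only [y]; linarith
      have e4 : k * (ρ / (N + 1)) + y N = x := by simp [y, ← hk]
      have e3 := hadd (k * (ρ / (N + 1))) (y N) (by rw [abs_of_nonneg hk0]; linarith)
        (by rw [abs_of_nonneg (hy N).1]; linarith)
        (by rw [e4, abs_of_nonneg hx0]; linarith)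
      rw [e4] at e3
      have e5 : ((x / ρ : ℝ) : ℂ) = k / (N + 1) + (y N / ρ : ℝ) := by
        have : x / ρ = k / (N + 1) + y N / ρ := by
          rw [← e4]; simp only [y]; field_simp
        rw [this]; push_cast; rfl
      have hN' : ((N : ℂ) + 1) ≠ 0 := by exact_mod_cast hN.ne'
      rw [e5, e3, e2]
      have e6 : (k : ℂ) / (N + 1) * A ρ = k * A (ρ / (N + 1)) := by
        rw [e1]; field_simp
      linear_combination -e6
    have hy0 : Tendsto y atTop (𝓝 0) := by
      refine squeeze_zero (fun N ↦ (hy N).1) (fun N ↦ (hy N).2) ?_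
      exact tendsto_const_div_atTop_nhds_zero_nat ρ |>.comp (tendsto_add_atTop_nat 1) |>.congr
        (by intro N; simp)
    have hlim : Tendsto (fun N ↦ A (y N) - (y N / ρ : ℝ) * A ρ) atTop (𝓝 0) := by
      have h1 := hc.tendsto.comp hy0
      have h2 : Tendsto (fun N ↦ ((y N / ρ : ℝ) : ℂ) * A ρ) atTop (𝓝 (((0 / ρ : ℝ) : ℂ) * A ρ)) :=
        ((Complex.continuous_ofReal.tendsto _).comp (hy0.div_const ρ)).mul_const _
      simpa [h0] using h1.sub h2
    have := tendsto_nhds_unique (tendsto_const_nhds.congr hval) hlim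
    exact sub_eq_zero.mp this
  rcases le_total 0 x with hx0 | hx0
  · exact key x hx0 (le_of_abs_le hx)
  · have hx' : -x ≤ ρ := (neg_le_abs x).trans hx
    have h1 := key (-x) (by linarith) hx'
    rw [hneg x (hx.trans_lt hρr)] at h1
    push_cast at h1 ⊢
    linear_combination -h1

/-- The conclusion of vanishing local second differences. -/
lemma exists_affine_of_secondDiff {f : ℝ → ℂ} {r : ℝ} (hr : 0 < r)
    (hc : ∀ x, |x| < r → ContinuousAt f x)
    (h : ∀ x y, |x| < r → |y| < r → f (x + y) - f x - f y + f 0 = 0) :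
    ∃ c : ℂ, ∃ ρ > 0, ∀ x, |x| < ρ → f x = f 0 + c * x := by
  refine ⟨(f (r / 2) - f 0) / (r / 2), r / 2, by positivity, fun x hx ↦ ?_⟩
  have := eq_mul_of_locally_additive (A := fun x ↦ f x - f 0) (half_pos hr) (half_lt_self hr)
    (fun x y hx hy _ ↦ by linear_combination h x y hx hy)
    ((hc 0 (by simpa)).sub continuousAt_const) hx.le
  push_cast at this
  linear_combination this

/-- The second difference is locally additive in each argument, hence bilinear. That of `x ^ 2` is
`2 * x * y`, so subtracting `C / (2 * ρ ^ 2) * x ^ 2` reduces to vanishing second differences. -/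
lemma exists_quadratic_of_thirdDiff {f : ℝ → ℂ} {r : ℝ} (hr : 0 < r)
    (hc : ∀ x, |x| < r → ContinuousAt f x)
    (h : ∀ x y z, |x| < r → |y| < r → |z| < r →
      f (x + y + z) - f (x + y) - f (x + z) - f (y + z) + f x + f y + f z - f 0 = 0) :
    ∃ c d : ℂ, ∃ ρ > 0, ∀ x, |x| < ρ → f x = f 0 + c * x + d * x ^ 2 := by
  set ρ := r / 4 with hρ
  have hρ0 : 0 < ρ := by positivity
  have hadd : ∀ y, |y| ≤ ρ → ∀ x, |x| ≤ ρ → f (x + y) - f x - f y + f 0 =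
      (x / ρ : ℝ) * (f (ρ + y) - f ρ - f y + f 0) := by
    intro y hy x hx
    refine eq_mul_of_locally_additive (A := fun x ↦ f (x + y) - f x - f y + f 0) (r := r / 2)
      hρ0 (by linarith) (fun x x' hx hx' _ ↦ ?_) ?_ hx
    · have := h x x' y (by linarith) (by linarith) (by linarith)
      linear_combination this
    · have h1 : ContinuousAt (fun x ↦ f (x + y)) 0 :=
        ContinuousAt.comp' (by simpa using hc y (by linarith)) (by fun_prop)
      exact ((h1.sub (hc 0 (by simpa))).sub continuousAt_const).add continuousAt_const
  set C := f (ρ + ρ) - f ρ - f ρ + f 0 with hC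
  have hquad : ∀ x y, |x| ≤ ρ → |y| ≤ ρ →
      f (x + y) - f x - f y + f 0 = (x / ρ : ℝ) * (y / ρ : ℝ) * C := by
    intro x y hx hy
    have h1 := hadd y hy x hx
    have h2 := hadd ρ (abs_of_pos hρ0).le y hy
    rw [add_comm ρ y] at h1
    linear_combination h1 + (x / ρ : ℝ) * h2
  have hρC : (ρ : ℂ) ≠ 0 := by exact_mod_cast hρ0.ne'
  obtain ⟨c, σ, hσ, hfin⟩ := exists_affine_of_secondDiff (f := fun x ↦ f x - C / (2 * ρ ^ 2) * x ^ 2)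
    hρ0 (fun x hx ↦ (hc x (by linarith)).sub (by fun_prop)) (fun x y hx hy ↦ by
      have := hquad x y hx.le hy.le
      push_cast at this ⊢
      rw [show f (x + y) = (x / ρ) * (y / ρ) * C + f x + f y - f 0 by linear_combination this]
      field_simp
      ring)
  refine ⟨c, C / (2 * ρ ^ 2), σ, hσ, fun x hx ↦ ?_⟩
  have := hfin x hx
  push_cast at this
  linear_combination this

/-- The same reduction one degree higher: the symmetric third difference `D` is trilinear near `0`,
and that of `x ^ 3` is `6 * x * y * z`. -/
lemma exists_cubic_of_fourthDiff {f : ℝ → ℂ} {r : ℝ} (hr : 0 < r)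
    (hc : ∀ x, |x| < r → ContinuousAt f x)
    (h : ∀ x y z w, |x| < r → |y| < r → |z| < r → |w| < r →
      f (x + y + z + w) - f (x + y + z) - f (x + y + w) - f (x + z + w) - f (y + z + w)
       + f (x + y) + f (x + z) + f (x + w) + f (y + z) + f (y + w) + f (z + w)
       - f x - f y - f z - f w + f 0 = 0) :
    ∃ c d e : ℂ, ∃ ρ > 0, ∀ x, |x| < ρ → f x = f 0 + c * x + d * x ^ 2 + e * x ^ 3 := by
  set ρ := r / 4 with hρ
  have hρ0 : 0 < ρ := by positivity
  let D : ℝ → ℝ → ℝ → ℂ := fun x y z ↦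
    f (x + y + z) - f (x + y) - f (x + z) - f (y + z) + f x + f y + f z - f 0
  have hD1 : ∀ x y z, D x y z = D y x z := by
    intro x y z; simp only [D]; rw [add_comm y x]; ring
  have hD2 : ∀ x y z, D x y z = D z y x := by
    intro x y z; simp only [D]
    rw [show z + y + x = x + y + z by ring, add_comm z y, add_comm z x, add_comm y x]; ring
  have hadd : ∀ y z, |y| ≤ ρ → |z| ≤ ρ → ∀ x, |x| ≤ ρ → D x y z = (x / ρ : ℝ) * D ρ y z := by
    intro y z hy hz x hx
    refine eq_mul_of_locally_additive (A := fun x ↦ D x y z) (r := r / 2)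
      hρ0 (by linarith) (fun x x' hx hx' _ ↦ ?_) ?_ hx
    · have := h x x' y z (by linarith) (by linarith) (by linarith) (by linarith)
      simp only [D]
      linear_combination this
    · have h2 : ∀ a, |a| < r → ContinuousAt (fun x ↦ f (x + a)) 0 := fun a ha ↦
        ContinuousAt.comp' (by simpa using hc a ha) (by fun_prop)
      have h3 : ContinuousAt (fun x ↦ f (x + y + z)) 0 := by
        simp only [add_assoc]
        exact h2 _ ((abs_add_le y z).trans_lt (by linarith))
      exact ((((((h3.sub (h2 y (by linarith))).sub (h2 z (by linarith))).sub
        continuousAt_const).add (hc 0 (by simpa))).add continuousAt_const).add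
        continuousAt_const).sub continuousAt_const
  have hρa : |ρ| ≤ ρ := (abs_of_pos hρ0).le
  set C := D ρ ρ ρ with hC
  have hcub : ∀ x y z, |x| ≤ ρ → |y| ≤ ρ → |z| ≤ ρ →
      D x y z = (x / ρ : ℝ) * (y / ρ : ℝ) * (z / ρ : ℝ) * C := by
    intro x y z hx hy hz
    rw [hadd y z hy hz x hx, hD1, hadd ρ z hρa hz y hy, hD2, hadd ρ ρ hρa hρa z hz]
    ring
  have hρC : (ρ : ℂ) ≠ 0 := by exact_mod_cast hρ0.ne'
  obtain ⟨c, d, σ, hσ, hfin⟩ := exists_quadratic_of_thirdDiff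
    (f := fun x ↦ f x - C / (6 * ρ ^ 3) * x ^ 3)
    hρ0 (fun x hx ↦ (hc x (by linarith)).sub (by fun_prop)) (fun x y z hx hy hz ↦ by
      have := hcub x y z hx.le hy.le hz.le
      simp only [D] at this
      push_cast at this ⊢
      rw [show f (x + y + z) = (x / ρ) * (y / ρ) * (z / ρ) * C + f (x + y) + f (x + z) + f (y + z)
        - f x - f y - f z + f 0 by linear_combination this]
      field_simp
      ring)
  refine ⟨c, d, C / (6 * ρ ^ 3), σ, hσ, fun x hx ↦ ?_⟩
  have := hfin x hx
  push_cast at this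
  linear_combination this

end LocalPolynomial

/-! ### A local Marcinkiewicz theorem for cubic exponents. -/

section Marcinkiewicz

open scoped ENNReal

lemma ofReal_sin_pow_eq_sum (n : ℕ) (θ : ℝ) :
    ((Real.sin θ ^ (2 * n) : ℝ) : ℂ) = ∑ k ∈ Finset.range (2 * n + 1),
      ((-1 / 4) ^ n * (-1) ^ (2 * n - k) * ((2 * n).choose k : ℂ)) *
        Complex.exp (((2 * k - 2 * n : ℝ) * θ : ℝ) * Complex.I) := by
  have h1 : ((Real.sin θ ^ (2 * n) : ℝ) : ℂ) = (-1 / 4) ^ n *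
      (Complex.exp (θ * Complex.I) + -Complex.exp (-(θ * Complex.I))) ^ (2 * n) := by
    push_cast
    rw [Complex.sin, pow_mul, pow_mul, ← mul_pow, neg_mul]
    congr 1
    ring_nf
    rw [Complex.I_sq]
    ring
  rw [h1, add_pow, Finset.mul_sum]
  refine Finset.sum_congr rfl fun k hk ↦ ?_
  have hk' : k ≤ 2 * n := by
    have := Finset.mem_range.1 hk
    omega
  rw [neg_pow, ← Complex.exp_nat_mul, ← Complex.exp_nat_mul,
    show (((2 * k - 2 * n : ℝ) * θ : ℝ) : ℂ) * Complex.I =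
      (k : ℕ) * (θ * Complex.I) + ((2 * n - k : ℕ) : ℂ) * (-(θ * Complex.I)) by
        push_cast [Nat.cast_sub hk']; ring, Complex.exp_add]
  ring

variable {μ ν : Measure ℝ} [IsProbabilityMeasure μ] [IsProbabilityMeasure ν]

/-- The integrand is a trigonometric polynomial with frequencies of modulus at most `2 * n * s`,
where the characteristic functions agree. -/
lemma integral_sin_pow_eq {ε : ℝ} (h : ∀ t, |t| < ε → charFun μ t = charFun ν t) {n : ℕ} {s : ℝ}
    (hs : 0 ≤ s) (hns : 2 * n * s < ε) :
    ∫ x, Real.sin (s * x) ^ (2 * n) ∂μ = ∫ x, Real.sin (s * x) ^ (2 * n) ∂ν := by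
  have key : ∀ (ρ : Measure ℝ) [IsProbabilityMeasure ρ],
      ((∫ x, Real.sin (s * x) ^ (2 * n) ∂ρ : ℝ) : ℂ) = ∑ k ∈ Finset.range (2 * n + 1),
      ((-1 / 4) ^ n * (-1) ^ (2 * n - k) * ((2 * n).choose k : ℂ)) *
        charFun ρ ((2 * k - 2 * n : ℝ) * s) := by
    intro ρ _
    rw [← integral_complex_ofReal]
    simp_rw [ofReal_sin_pow_eq_sum]
    rw [integral_finsetSum]
    · refine Finset.sum_congr rfl fun k _ ↦ ?_
      rw [integral_const_mul, charFun_apply_real]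
      congr 2 with x
      push_cast; ring_nf
    · intro k _
      refine Integrable.const_mul ?_ _
      refine Integrable.of_bound (C := 1) (by fun_prop) (ae_of_all _ fun x ↦ ?_)
      rw [Complex.norm_exp_ofReal_mul_I]
  apply Complex.ofReal_injective
  rw [key μ, key ν]
  refine Finset.sum_congr rfl fun k hk ↦ ?_
  congr 1
  apply h
  have hk' : (k : ℝ) ≤ 2 * n := by
    have := Finset.mem_range.1 hk
    exact_mod_cast (show k ≤ 2 * n by omega)
  have hk0 : (0 : ℝ) ≤ k := by positivity
  rw [abs_mul, abs_of_nonneg hs]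
  refine lt_of_le_of_lt ?_ hns
  refine mul_le_mul_of_nonneg_right ?_ hs
  rw [abs_le]; constructor <;> linarith

/-- If two characteristic functions agree near `0`, then the even moments of the two laws
satisfy this inequality, without assuming that they are finite. -/
lemma lintegral_even_moment_le {ε : ℝ} (hε : 0 < ε)
    (h : ∀ t, |t| < ε → charFun μ t = charFun ν t) (n : ℕ) :
    ∫⁻ x, ENNReal.ofReal (x ^ (2 * n)) ∂μ ≤ ∫⁻ x, ENNReal.ofReal (x ^ (2 * n)) ∂ν := by
  let s : ℕ → ℝ := fun j ↦ ε / (2 * n + 1) / (j + 1)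
  have hs0 : ∀ j, 0 < s j := fun j ↦ by positivity
  have hsn : ∀ j, 2 * n * s j < ε := fun j ↦ by
    have h1 : s j ≤ ε / (2 * n + 1) := div_le_self (by positivity) (by simp)
    have h2 : (2 * n + 1) * (ε / (2 * n + 1)) = ε := by field_simp
    have h3 : (2 * n + 1) * s j ≤ (2 * n + 1) * (ε / (2 * n + 1)) :=
      mul_le_mul_of_nonneg_left h1 (by positivity)
    have := hs0 j
    linarith
  have hst : Tendsto s atTop (𝓝 0) :=
    (tendsto_const_div_atTop_nhds_zero_nat (ε / (2 * n + 1))).comp (tendsto_add_atTop_nat 1)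
      |>.congr (by intro N; simp [s])
  have hlim : ∀ x : ℝ, Tendsto (fun j ↦ Real.sin (s j * x) / s j) atTop (𝓝 x) := by
    intro x
    have h1 : HasDerivAt (fun u : ℝ ↦ Real.sin (u * x)) x 0 := by
      have := (((hasDerivAt_id (0 : ℝ)).mul_const x).sin)
      simpa using this
    have h2 := h1.tendsto_slope_zero
    have h3 : Tendsto s atTop (𝓝[≠] 0) :=
      tendsto_nhdsWithin_iff.2 ⟨hst, Eventually.of_forall fun j ↦ (hs0 j).ne'⟩
    refine (h2.comp h3).congr fun j ↦ ?_
    simp [div_eq_inv_mul]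
  have hconv : ∀ (ρ : Measure ℝ) [IsProbabilityMeasure ρ] (j : ℕ),
      ∫⁻ x, ENNReal.ofReal ((Real.sin (s j * x) / s j) ^ (2 * n)) ∂ρ =
        ENNReal.ofReal ((∫ x, Real.sin (s j * x) ^ (2 * n) ∂ρ) / s j ^ (2 * n)) := by
    intro ρ _ j
    rw [← integral_div, ofReal_integral_eq_lintegral_ofReal]
    · simp_rw [div_pow]
    · refine (Integrable.of_bound (C := 1) (by fun_prop) (ae_of_all _ fun x ↦ ?_)).div_const _
      rw [norm_pow, Real.norm_eq_abs]
      exact pow_le_one₀ (abs_nonneg _) (Real.abs_sin_le_one _)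
    · refine ae_of_all _ fun x ↦ ?_
      have := hs0 j
      have : 0 ≤ Real.sin (s j * x) ^ (2 * n) := (even_two_mul n).pow_nonneg _
      simp only [Pi.zero_apply]
      positivity
  -- Fatou's lemma on the side of `μ` and `|sin u| ≤ |u|` on the side of `ν`.
  calc ∫⁻ x, ENNReal.ofReal (x ^ (2 * n)) ∂μ
      = ∫⁻ x, liminf (fun j ↦ ENNReal.ofReal ((Real.sin (s j * x) / s j) ^ (2 * n))) atTop ∂μ := by
        refine lintegral_congr fun x ↦ ?_
        exact (ENNReal.tendsto_ofReal ((hlim x).pow (2 * n))).liminf_eq.symm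
    _ ≤ liminf (fun j ↦ ∫⁻ x, ENNReal.ofReal ((Real.sin (s j * x) / s j) ^ (2 * n)) ∂μ) atTop :=
        lintegral_liminf_le fun j ↦ by fun_prop
    _ = liminf (fun j ↦ ∫⁻ x, ENNReal.ofReal ((Real.sin (s j * x) / s j) ^ (2 * n)) ∂ν) atTop := by
        congr 1 with j
        rw [hconv μ, hconv ν, integral_sin_pow_eq h (hs0 j).le (hsn j)]
    _ ≤ liminf (fun _ : ℕ ↦ ∫⁻ x, ENNReal.ofReal (x ^ (2 * n)) ∂ν) atTop := by
        refine liminf_le_liminf (Eventually.of_forall fun j ↦ ?_)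
        refine lintegral_mono fun x ↦ ENNReal.ofReal_le_ofReal ?_
        rw [pow_mul, pow_mul]
        refine pow_le_pow_left₀ (sq_nonneg _) (sq_le_sq.2 ?_) n
        rw [abs_div, abs_of_pos (hs0 j), div_le_iff₀ (hs0 j)]
        refine (Real.abs_sin_le_abs).trans ?_
        rw [abs_mul, abs_of_pos (hs0 j), mul_comm]
    _ = _ := by simp

/-- The power series of `cosh` has only even terms with nonnegative coefficients, so the moment
comparison passes through it term by term. -/
lemma lintegral_cosh_le {ε : ℝ} (hε : 0 < ε)
    (h : ∀ t, |t| < ε → charFun μ t = charFun ν t) (t : ℝ) :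
    ∫⁻ x, ENNReal.ofReal (Real.cosh (t * x)) ∂μ ≤ ∫⁻ x, ENNReal.ofReal (Real.cosh (t * x)) ∂ν := by
  have key : ∀ ρ : Measure ℝ, ∫⁻ x, ENNReal.ofReal (Real.cosh (t * x)) ∂ρ =
      ∑' n : ℕ, ENNReal.ofReal (t ^ (2 * n) / (2 * n).factorial) *
        ∫⁻ x, ENNReal.ofReal (x ^ (2 * n)) ∂ρ := by
    intro ρ
    have hn : ∀ (x : ℝ) (n : ℕ), 0 ≤ x ^ (2 * n) := fun x n ↦ (even_two_mul n).pow_nonneg _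
    simp_rw [Real.cosh_eq_tsum]
    have h1 : ∀ x, ENNReal.ofReal (∑' n : ℕ, (t * x) ^ (2 * n) / (2 * n).factorial) =
        ∑' n : ℕ, ENNReal.ofReal (t ^ (2 * n) / (2 * n).factorial) *
          ENNReal.ofReal (x ^ (2 * n)) := by
      intro x
      rw [ENNReal.ofReal_tsum_of_nonneg (fun n ↦ div_nonneg (hn _ _) (by positivity))
        (Real.hasSum_cosh _).summable]
      congr 1 with n
      rw [← ENNReal.ofReal_mul (div_nonneg (hn _ _) (by positivity)), mul_pow]
      congr 1; ring
    simp_rw [h1]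
    rw [lintegral_tsum fun n ↦ by fun_prop]
    congr 1 with n
    rw [lintegral_const_mul _ (by fun_prop)]
  rw [key, key]
  exact ENNReal.tsum_le_tsum fun n ↦ mul_le_mul_right (lintegral_even_moment_le hε h n) _

lemma integrable_exp_mul_of_charFun_eq_gaussianReal {ε m : ℝ} {v : NNReal} (hε : 0 < ε)
    (h : ∀ t, |t| < ε → charFun μ t = charFun (gaussianReal m v) t) (t : ℝ) :
    Integrable (fun x ↦ Real.exp (t * x)) μ := by
  have hfin : ∫⁻ x, ENNReal.ofReal (Real.cosh (t * x)) ∂(gaussianReal m v) < ∞ := by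
    have hi : Integrable (fun x ↦ Real.cosh (t * x)) (gaussianReal m v) := by
      have := ((integrable_exp_mul_gaussianReal (μ := m) (v := v) t).add
        (integrable_exp_mul_gaussianReal (μ := m) (v := v) (-t))).div_const 2
      refine this.congr (ae_of_all _ fun x ↦ ?_)
      simp [Real.cosh_eq]
    exact hi.lintegral_lt_top
  have hfin' := (lintegral_cosh_le hε h t).trans_lt hfin
  have hi : Integrable (fun x ↦ Real.cosh (t * x)) μ := by
    refine ⟨by fun_prop, ?_⟩
    rw [hasFiniteIntegral_iff_ofReal (ae_of_all _ fun x ↦ (Real.cosh_pos _).le)]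
    exact hfin'
  refine (hi.const_mul 2).mono' (by fun_prop) (ae_of_all _ fun x ↦ ?_)
  rw [Real.norm_eq_abs, abs_of_pos (Real.exp_pos _), Real.cosh_eq]
  have := Real.exp_pos (-(t * x))
  linarith

/-- If the symmetrization of a law has a Gaussian characteristic function near `0`, then the law has
all exponential moments. -/
lemma integrable_exp_mul_of_symmetrization {ε : ℝ} {v : NNReal} (hε : 0 < ε)
    (h : ∀ t, |t| < ε → charFun μ t * charFun μ (-t) = charFun (gaussianReal 0 v) t) (t : ℝ) :
    Integrable (fun x ↦ Real.exp (t * x)) μ := by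
  have hmeas : Measurable (fun x : ℝ ↦ -1 * x) := by fun_prop
  have : IsProbabilityMeasure (μ.map fun x ↦ -1 * x) :=
    Measure.isProbabilityMeasure_map hmeas.aemeasurable
  have h1 := integrable_exp_mul_of_charFun_eq_gaussianReal
    (μ := μ ∗ (μ.map fun x ↦ -1 * x)) hε (m := 0) (v := v) (fun s hs ↦ by
      rw [charFun_conv, charFun_map_mul, neg_one_mul, h s hs]) t
  rw [Measure.conv, integrable_map_measure (by fun_prop) (by fun_prop)] at h1
  -- By Fubini, `exp (t * (x + y))` is integrable in `x` for some fixed value `y` of the reflected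
  -- copy; the constant factor `exp (t * y)` is then removed.
  have h2 := h1.prod_left_ae
  obtain ⟨y, hy⟩ := h2.exists
  refine (hy.mul_const (Real.exp (-(t * y)))).congr (ae_of_all _ fun x ↦ ?_)
  simp only [Function.comp_apply]
  rw [← Real.exp_add]
  ring_nf

/-- A law whose characteristic function is near `0` the exponential of a cubic polynomial
is Gaussian. -/
lemma isGaussian_of_charFun_eq_exp_cubic {c d e : ℂ} {ε : ℝ} (hε : 0 < ε)
    (hint : ∀ t : ℝ, Integrable (fun x ↦ Real.exp (t * x)) μ)
    (h : ∀ t : ℝ, |t| < ε → charFun μ t = Complex.exp (c * t + d * t ^ 2 + e * t ^ 3)) :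
    IsGaussian μ := by
  set p : ℂ := -Complex.I * c with hp
  set r : ℂ := -d with hr
  set s : ℂ := Complex.I * e with hs
  have hset : integrableExpSet id μ = Set.univ := by
    ext t; simpa [integrableExpSet] using hint t
  -- The exponential moments make the transform entire, so the formula, known on the imaginary axis
  -- near `0`, holds everywhere.
  have hM : complexMGF id μ = fun z ↦ Complex.exp (p * z + r * z ^ 2 + s * z ^ 3) := by
    refine AnalyticOnNhd.eq_of_frequently_eq (z₀ := 0) ?_ ?_ ?_
    · intro z _
      exact analyticAt_complexMGF (by simp [hset])
    · exact fun z _ ↦ Differentiable.analyticAt (by fun_prop) z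
    · have ht : Tendsto (fun t : ℝ ↦ (t : ℂ) * Complex.I) (𝓝[≠] 0) (𝓝[≠] 0) := by
        refine tendsto_nhdsWithin_iff.2 ⟨?_, ?_⟩
        · refine Tendsto.mono_left ?_ nhdsWithin_le_nhds
          exact Continuous.tendsto' (by fun_prop) _ _ (by simp)
        · filter_upwards [self_mem_nhdsWithin] with t ht
          simpa using ht
      refine ht.frequently (Eventually.frequently ?_)
      have : ∀ᶠ t : ℝ in 𝓝 0, |t| < ε := by
        have := Metric.ball_mem_nhds (0 : ℝ) hε
        filter_upwards [this] with t ht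
        simpa using ht
      filter_upwards [nhdsWithin_le_nhds this] with t ht
      rw [complexMGF_id_mul_I, h t ht]
      congr 1
      simp only [hp, hr, hs]
      linear_combination (c * t) * Complex.I_sq + (d * t ^ 2) * Complex.I_sq
        + (-e * t ^ 3 * (Complex.I ^ 2 - 1)) * Complex.I_sq
  -- The ridge property `‖M (x + i y)‖ ≤ M x`; it forces the cubic exponent to be a real quadratic.
  have hle : ∀ x y : ℝ, (p * (x + y * Complex.I) + r * (x + y * Complex.I) ^ 2 +
      s * (x + y * Complex.I) ^ 3).re ≤ (p * x + r * x ^ 2 + s * x ^ 3).re := by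
    intro x y
    have h1 : ‖complexMGF id μ (x + y * Complex.I)‖ ≤ ‖complexMGF id μ x‖ := by
      refine norm_complexMGF_le_mgf.trans ?_
      rw [complexMGF_ofReal, Complex.norm_real, Real.norm_eq_abs]
      simpa using le_abs_self _
    rw [hM, Complex.norm_exp, Complex.norm_exp] at h1
    exact Real.exp_le_exp.1 h1
  have hle' : ∀ x y : ℝ, -(p.im * y) - 2 * x * y * r.im - 3 * x ^ 2 * y * s.im
      - y ^ 2 * (r.re + 3 * x * s.re) + y ^ 3 * s.im ≤ 0 := by
    intro x y
    have := hle x y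
    simp only [pow_succ, pow_zero, one_mul, Complex.add_re, Complex.mul_re, Complex.mul_im,
      Complex.add_im, Complex.ofReal_re, Complex.ofReal_im, Complex.I_re, Complex.I_im] at this
    ring_nf at this ⊢
    linarith
  have hlin : ∀ A B C : ℝ, (∀ y : ℝ, A * y + B * y ^ 2 + C * y ^ 3 ≤ 0) → A = 0 ∧ B ≤ 0 := by
    intro A B C h
    have hB : B ≤ 0 := by
      have h1 := h 1
      have h2 := h (-1)
      linarith
    refine ⟨?_, hB⟩
    by_contra hA
    have hlim : Tendsto (fun y : ℝ ↦ A ^ 2 + B * A ^ 2 * y + C * A ^ 3 * y ^ 2) (𝓝[>] 0)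
        (𝓝 (A ^ 2)) := by
      refine Tendsto.mono_left ?_ nhdsWithin_le_nhds
      exact Continuous.tendsto' (by fun_prop) _ _ (by simp)
    have : A ^ 2 ≤ 0 := by
      refine le_of_tendsto hlim ?_
      filter_upwards [self_mem_nhdsWithin] with y hy
      -- At `A * y` the linear term is `A ^ 2 * y`; after division by `y > 0` the limit `y → 0`
      -- gives `A ^ 2 ≤ 0`.
      have h1 := h (A * y)
      have hy' : 0 < y := hy
      by_contra hcon
      push Not at hcon
      have := mul_pos hy' hcon
      nlinarith
    exact hA (by nlinarith [sq_nonneg A])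
  have hx : ∀ x : ℝ, p.im + 2 * x * r.im + 3 * x ^ 2 * s.im = 0 ∧ 0 ≤ r.re + 3 * x * s.re := by
    intro x
    have := hlin (-(p.im + 2 * x * r.im + 3 * x ^ 2 * s.im)) (-(r.re + 3 * x * s.re)) s.im
      (fun y ↦ by have := hle' x y; linarith)
    exact ⟨by linarith [this.1], by linarith [this.2]⟩
  have h0 := (hx 0).1
  have h1 := (hx 1).1
  have h2 := (hx (-1)).1
  have hpi : p.im = 0 := by linarith
  have hri : r.im = 0 := by linarith
  have hsi : s.im = 0 := by linarith
  have hr0 : 0 ≤ r.re := by have := (hx 0).2; linarith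
  have hsr : s.re = 0 := by
    by_contra hne
    have := (hx (-(r.re + 1) / (3 * s.re))).2
    have h3 : r.re + 3 * (-(r.re + 1) / (3 * s.re)) * s.re = -1 := by field_simp; ring
    linarith
  have hpe : p = (p.re : ℂ) := Complex.ext rfl hpi
  have hre : r = (r.re : ℂ) := Complex.ext rfl hri
  have hse : s = 0 := Complex.ext hsr hsi
  have : μ = gaussianReal p.re (2 * r.re.toNNReal) := by
    refine Measure.ext_of_charFun ?_
    ext t
    rw [charFun_gaussianReal, ← complexMGF_id_mul_I, hM]
    simp only
    rw [hse]
    congr 1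
    push_cast
    rw [Real.coe_toNNReal _ hr0, ← hpe, ← hre]
    ring_nf
    rw [Complex.I_sq]; ring
  rw [this]
  infer_instance

lemma isGaussian_of_log_charFun_cubic {c d e : ℂ} {ε : ℝ} (hε : 0 < ε)
    (h : ∀ t : ℝ, |t| < ε → Complex.log (charFun μ t) = c * t + d * t ^ 2 + e * t ^ 3) :
    IsGaussian μ := by
  have hcont : Continuous (charFun μ) := continuous_charFun
  have hslit : ∀ᶠ t in 𝓝 (0 : ℝ), charFun μ t ∈ Complex.slitPlane := by
    refine hcont.continuousAt.eventually_mem (Complex.isOpen_slitPlane.mem_nhds ?_)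
    simp
  obtain ⟨δ, hδ, hslit⟩ := Metric.eventually_nhds_iff.1 hslit
  set σ := min ε δ with hσ
  have hσ0 : 0 < σ := lt_min hε hδ
  have hs : ∀ t : ℝ, |t| < σ → charFun μ t ∈ Complex.slitPlane := fun t ht ↦
    hslit (by simpa using ht.trans_le (min_le_right _ _))
  have hexp : ∀ t : ℝ, |t| < σ → charFun μ t = Complex.exp (c * t + d * t ^ 2 + e * t ^ 3) := by
    intro t ht
    rw [← h t (ht.trans_le (min_le_left _ _)),
      Complex.exp_log (Complex.slitPlane_ne_zero (hs t ht))]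
  -- Conjugate symmetry `t ↦ -t` cancels the odd terms. So `d` is real, and nonpositive because a
  -- characteristic function has modulus at most `1`.
  have hd : ∀ t : ℝ, |t| < σ → d * t ^ 2 = ((Complex.log (charFun μ t)).re : ℂ) := by
    intro t ht
    have h1 := h t (ht.trans_le (min_le_left _ _))
    have h2 := h (-t) (by simpa using ht.trans_le (min_le_left _ _))
    rw [charFun_neg, Complex.log_conj _ (Complex.slitPlane_arg_ne_pi (hs t ht))] at h2
    have h3 := Complex.add_conj (Complex.log (charFun μ t))
    rw [h2, h1] at h3
    rw [h1]
    push_cast at h3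
    linear_combination h3 / 2
  have hdσ := hd (σ / 2) (by rw [abs_of_pos (by positivity)]; linarith)
  have hdle : (Complex.log (charFun μ (σ / 2))).re ≤ 0 := by
    rw [Complex.log_re]
    exact Real.log_nonpos (norm_nonneg _) (norm_charFun_le_one _)
  have hdr : d = ((Complex.log (charFun μ (σ / 2))).re / (σ / 2) ^ 2 : ℝ) := by
    have : (σ : ℂ) ≠ 0 := by exact_mod_cast hσ0.ne'
    push_cast at hdσ ⊢
    rw [← hdσ]
    field_simp
  set D : ℝ := (Complex.log (charFun μ (σ / 2))).re / (σ / 2) ^ 2 with hD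
  have hD0 : D ≤ 0 := div_nonpos_of_nonpos_of_nonneg hdle (by positivity)
  refine isGaussian_of_charFun_eq_exp_cubic hσ0 (fun t ↦ ?_) hexp
  -- The symmetrization has characteristic function `exp (2 * D * t ^ 2)` near `0`, that of a
  -- centred normal law of variance `-4 * D`.
  refine integrable_exp_mul_of_symmetrization (v := 4 * (-D).toNNReal) hσ0 (fun t ht ↦ ?_) t
  rw [hexp t ht, hexp (-t) (by simpa using ht), ← Complex.exp_add, charFun_gaussianReal]
  congr 1
  rw [hdr]
  push_cast
  rw [Real.coe_toNNReal _ (by linarith)]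
  push_cast
  ring

/-- If all fourth differences at `0` of the logarithm of a characteristic function vanish for small
steps, then the law is Gaussian. -/
theorem isGaussian_of_fourthDiff_log_charFun
    (h : ∀ᶠ p : ℝ × ℝ × ℝ × ℝ in 𝓝 0, fwdDiff p.1 (fwdDiff p.2.1 (fwdDiff p.2.2.1 (fwdDiff p.2.2.2
      fun x ↦ Complex.log (charFun μ x)))) 0 = 0) : IsGaussian μ := by
  have hcont : Continuous (charFun μ) := continuous_charFun
  have hslit : ∀ᶠ t in 𝓝 (0 : ℝ), charFun μ t ∈ Complex.slitPlane := by
    refine hcont.continuousAt.eventually_mem (Complex.isOpen_slitPlane.mem_nhds ?_)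
    simp
  obtain ⟨δ, hδ, hslit⟩ := Metric.eventually_nhds_iff.1 hslit
  obtain ⟨ε, hε, h⟩ := Metric.eventually_nhds_iff.1 h
  obtain ⟨c, d, e, ρ, hρ, hcub⟩ := exists_cubic_of_fourthDiff
    (f := fun x ↦ Complex.log (charFun μ x)) (lt_min hε hδ)
    (fun x hx ↦ hcont.continuousAt.clog (hslit (by simpa using hx.trans_le (min_le_right _ _))))
    (fun x y z w hx hy hz hw ↦ by
      have := @h (x, y, z, w) (by
        rw [dist_zero_right]
        simp only [Prod.norm_def, Real.norm_eq_abs]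
        have := min_le_left ε δ
        exact max_lt (by linarith) (max_lt (by linarith) (max_lt (by linarith) (by linarith))))
      simp only [fwdDiff, zero_add] at this
      linear_combination this)
  exact isGaussian_of_log_charFun_cubic hρ (fun t ht ↦ by simpa using hcub t ht)

end Marcinkiewicz

/-! ### Third differences of sums of functions of linear forms. -/

section Differences

variable {F : Type*} [AddCommGroup F]

/-- The third difference of `f` at `x` with steps `a`, `b`, `c`. -/
def thirdDiff (f : F → ℂ) (a b c x : F) : ℂ := fwdDiff a (fwdDiff b (fwdDiff c f)) x

lemma thirdDiff_eq (f : F → ℂ) (a b c x : F) : thirdDiff f a b c x =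
    f (x + a + b + c) - f (x + a + b) - (f (x + a + c) - f (x + a)) -
      (f (x + b + c) - f (x + b) - (f (x + c) - f x)) := by
  simp [thirdDiff, fwdDiff]

lemma thirdDiff_zero_left (f : F → ℂ) (b c x : F) : thirdDiff f 0 b c x = 0 := by
  simp [thirdDiff_eq]

lemma thirdDiff_zero_mid (f : F → ℂ) (a c x : F) : thirdDiff f a 0 c x = 0 := by
  simp [thirdDiff_eq]

lemma thirdDiff_zero_right (f : F → ℂ) (a b x : F) : thirdDiff f a b 0 x = 0 := by
  simp [thirdDiff_eq]

variable [Module ℝ F] {E : Type*} [AddCommGroup E] [Module ℝ E] [TopologicalSpace E]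
  [ContinuousAdd E] [ContinuousSMul ℝ E] {ι : Type*} [Fintype ι] {Λ Λ' : ι → E →ₗ[ℝ] F} {g g' : ι → F → ℂ}

lemma eventually_sum_thirdDiff_eq
    (H : ∀ᶠ w in 𝓝 (0 : E), ∑ s, g s (Λ s w) = ∑ s, g' s (Λ' s w)) (d₁ d₂ d₃ : E) :
    ∀ᶠ p : E × ℝ × ℝ × ℝ in 𝓝 0,
      ∑ s, thirdDiff (g s) (p.2.1 • Λ s d₁) (p.2.2.1 • Λ s d₂) (p.2.2.2 • Λ s d₃) (Λ s p.1) =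
      ∑ s, thirdDiff (g' s) (p.2.1 • Λ' s d₁) (p.2.2.1 • Λ' s d₂) (p.2.2.2 • Λ' s d₃)
        (Λ' s p.1) := by
  have pull : ∀ φ : E × ℝ × ℝ × ℝ → E, Continuous φ → φ 0 = 0 →
      ∀ᶠ p in 𝓝 0, ∑ s, g s (Λ s (φ p)) = ∑ s, g' s (Λ' s (φ p)) := fun φ hφ h0 ↦
    (hφ.tendsto' 0 0 h0).eventually H
  filter_upwards [
    pull (fun p ↦ p.1 + p.2.1 • d₁ + p.2.2.1 • d₂ + p.2.2.2 • d₃) (by fun_prop) (by simp),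
    pull (fun p ↦ p.1 + p.2.1 • d₁ + p.2.2.1 • d₂) (by fun_prop) (by simp),
    pull (fun p ↦ p.1 + p.2.1 • d₁ + p.2.2.2 • d₃) (by fun_prop) (by simp),
    pull (fun p ↦ p.1 + p.2.1 • d₁) (by fun_prop) (by simp),
    pull (fun p ↦ p.1 + p.2.2.1 • d₂ + p.2.2.2 • d₃) (by fun_prop) (by simp),
    pull (fun p ↦ p.1 + p.2.2.1 • d₂) (by fun_prop) (by simp),
    pull (fun p ↦ p.1 + p.2.2.2 • d₃) (by fun_prop) (by simp),
    pull (fun p ↦ p.1) (by fun_prop) (by simp)] with p h1 h2 h3 h4 h5 h6 h7 h8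
  simp only [map_add, map_smul] at h1 h2 h3 h4 h5 h6 h7 h8
  simp only [thirdDiff_eq, Finset.sum_sub_distrib, h1, h2, h3, h4, h5, h6, h7, h8]

/-- Third differences of the only summand that depends on both of two directions, when
the third direction is invisible to the corresponding summand on the other side. -/
lemma eventually_thirdDiff_eq_zero
    (H : ∀ᶠ w in 𝓝 (0 : E), ∑ s, g s (Λ s w) = ∑ s, g' s (Λ' s w)) {d₁ d₂ d₃ : E} {s₀ : ι}
    (h : ∀ s ≠ s₀, Λ s d₁ = 0 ∨ Λ s d₂ = 0) (h' : ∀ s ≠ s₀, Λ' s d₁ = 0 ∨ Λ' s d₂ = 0)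
    (h₃ : Λ' s₀ d₃ = 0) :
    ∀ᶠ p : E × ℝ × ℝ × ℝ in 𝓝 0,
      thirdDiff (g s₀) (p.2.1 • Λ s₀ d₁) (p.2.2.1 • Λ s₀ d₂) (p.2.2.2 • Λ s₀ d₃) (Λ s₀ p.1)
        = 0 := by
  filter_upwards [eventually_sum_thirdDiff_eq H d₁ d₂ d₃] with p hp
  classical
  rw [Finset.sum_eq_single s₀, Finset.sum_eq_zero] at hp
  · exact hp
  · intro s _
    rcases eq_or_ne s s₀ with rfl | hs
    · rw [h₃, smul_zero, thirdDiff_zero_right]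
    · rcases h' s hs with h0 | h0
      · rw [h0, smul_zero, thirdDiff_zero_left]
      · rw [h0, smul_zero, thirdDiff_zero_mid]
  · intro s _ hs
    rcases h s hs with h0 | h0
    · rw [h0, smul_zero, thirdDiff_zero_left]
    · rw [h0, smul_zero, thirdDiff_zero_mid]
  · simp

end Differences

/-! ### Isolating the shocks of periods `2` and `1`. -/

section Identification

variable {E : Type*} [AddCommGroup E] [Module ℝ E] {q T : ℕ}

/-- The loadings of the shocks of period `s` on the first difference of the earnings of
period `i`. -/
def IsDifferenceLoading (q T : ℕ) (β : ℤ → ℝ) (d : ℤ → E)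
    (Λ : Finset.Icc (1 - (q : ℤ)) (T : ℤ) → E →ₗ[ℝ] ℝ × ℝ) : Prop :=
  ∀ s, ∀ i ∈ Finset.Icc (2 : ℤ) T, Λ s (d i) = (β (i - s), if i = (s : ℤ) then 1 else 0)

variable {β β' : ℤ → ℝ} {d : ℤ → E}
  {Λ Λ' : Finset.Icc (1 - (q : ℤ)) (T : ℤ) → E →ₗ[ℝ] ℝ × ℝ}
  {g g' : Finset.Icc (1 - (q : ℤ)) (T : ℤ) → ℝ × ℝ → ℂ}

/-- With `x = β' j` and `y = β' i` this loading is a minor of `β` and `β'`, and it vanishes when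
computed with `β'` in place of `β`. The lags are at least `1`, so `η s` does not enter. -/
lemma IsDifferenceLoading.minor (hΛ : IsDifferenceLoading q T β d Λ) {i j : ℤ}
    {s : Finset.Icc (1 - (q : ℤ)) (T : ℤ)} (hs : 1 ≤ (s : ℤ)) (hsT : (s : ℤ) + (q + 1) ≤ T)
    (hi : i ∈ Finset.Icc (1 : ℤ) (q + 1)) (hj : j ∈ Finset.Icc (1 : ℤ) (q + 1)) (x y : ℝ) :
    Λ s (x • d (i + s) - y • d (j + s)) = (x * β i - y * β j, 0) := by
  rw [Finset.mem_Icc] at hi hj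
  rw [map_sub, map_smul, map_smul, hΛ s (i + s) (by rw [Finset.mem_Icc]; omega),
    hΛ s (j + s) (by rw [Finset.mem_Icc]; omega), if_neg (by omega), if_neg (by omega)]
  ext <;> simp

lemma IsDifferenceLoading.eq_zero_left (hΛ : IsDifferenceLoading q T β d Λ)
    (hneg : ∀ k < 0, β k = 0) {s : Finset.Icc (1 - (q : ℤ)) (T : ℤ)} {i : ℤ}
    (hi : i ∈ Finset.Icc (2 : ℤ) T) (h : i < s) : Λ s (d i) = 0 := by
  rw [hΛ s i hi, hneg _ (by omega), if_neg (by omega)]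
  rfl

lemma IsDifferenceLoading.eq_zero_right (hΛ : IsDifferenceLoading q T β d Λ)
    (hlarge : ∀ k > (q : ℤ) + 1, β k = 0) {s : Finset.Icc (1 - (q : ℤ)) (T : ℤ)} {i : ℤ}
    (hi : i ∈ Finset.Icc (2 : ℤ) T) (h : (s : ℤ) + (q + 1) < i) : Λ s (d i) = 0 := by
  rw [hΛ s i hi, hlarge _ (by omega), if_neg (by omega)]
  rfl

variable [TopologicalSpace E] [ContinuousAdd E] [ContinuousSMul ℝ E]

/-- Shocks before period `2` have died out by date `q + 3`, and shocks after it have not occurred at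
date `2`. The third direction is unseen by period `2` on the other side. -/
lemma eventually_thirdDiff_second_eq_zero
    (hT : q + 3 ≤ T) (hΛ : IsDifferenceLoading q T β d Λ) (hΛ' : IsDifferenceLoading q T β' d Λ')
    (hneg : ∀ k < 0, β k = 0) (hneg' : ∀ k < 0, β' k = 0)
    (hlarge : ∀ k > (q : ℤ) + 1, β k = 0) (hlarge' : ∀ k > (q : ℤ) + 1, β' k = 0)
    (hβ0 : β 0 = 1) (hβq : β (q + 1) ≠ 0)
    {i j : ℤ} (hi : i ∈ Finset.Icc (1 : ℤ) (q + 1)) (hj : j ∈ Finset.Icc (1 : ℤ) (q + 1))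
    (hij : β' j * β i - β' i * β j ≠ 0)
    (H : ∀ᶠ w in 𝓝 (0 : E), ∑ s, g s (Λ s w) = ∑ s, g' s (Λ' s w))
    {s : Finset.Icc (1 - (q : ℤ)) (T : ℤ)} (hs : (s : ℤ) = 2) :
    ∀ᶠ p : E × ℝ × ℝ × ℝ in 𝓝 0, thirdDiff (g s) (p.2.1 • (1, 1)) (p.2.2.1 • (1, 0))
      (p.2.2.2 • (1, 0)) (Λ s p.1) = 0 := by
  have h2 : (2 : ℤ) ∈ Finset.Icc (2 : ℤ) T := by rw [Finset.mem_Icc]; omega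
  have h3 : (q + 3 : ℤ) ∈ Finset.Icc (2 : ℤ) T := by rw [Finset.mem_Icc]; omega
  have key := eventually_thirdDiff_eq_zero H (d₁ := d 2) (d₂ := d (q + 3))
    (d₃ := β' j • d (i + s) - β' i • d (j + s)) (s₀ := s)
    (fun r hr ↦ by
      have hr' : (r : ℤ) ≠ 2 := fun h ↦ hr (Subtype.ext (h.trans hs.symm))
      rcases lt_or_gt_of_ne hr' with h | h
      · exact Or.inr (hΛ.eq_zero_right hlarge h3 (by omega))
      · exact Or.inl (hΛ.eq_zero_left hneg h2 h))
    (fun r hr ↦ by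
      have hr' : (r : ℤ) ≠ 2 := fun h ↦ hr (Subtype.ext (h.trans hs.symm))
      rcases lt_or_gt_of_ne hr' with h | h
      · exact Or.inr (hΛ'.eq_zero_right hlarge' h3 (by omega))
      · exact Or.inl (hΛ'.eq_zero_left hneg' h2 h))
    (by
      rw [hΛ'.minor (by omega) (by omega) hi hj, mul_comm, sub_self]
      rfl)
  rw [hΛ.minor (by omega) (by omega) hi hj, hΛ s 2 h2, hΛ s _ h3, if_pos hs.symm,
    if_neg (by omega), hs, show (q + 3 - 2 : ℤ) = q + 1 by ring, sub_self, hβ0] at key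
  -- Rescaling the steps turns the nonzero loadings `β (q + 1)` and the minor into `1`.
  have hcont : Continuous fun p : E × ℝ × ℝ × ℝ ↦ (p.1, p.2.1, p.2.2.1 / β (q + 1),
    p.2.2.2 / (β' j * β i - β' i * β j)) := by fun_prop
  filter_upwards [(hcont.tendsto' 0 0 (by ext <;> simp)).eventually key] with p hp
  simp only [Prod.smul_mk, smul_eq_mul, mul_zero, div_mul_cancel₀ _ hβq,
    div_mul_cancel₀ _ hij] at hp
  simpa using hp

/-- Differencing along dates `2`, `q + 2`, `q + 2` leaves periods `1` and `2`; the latter drops out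
by the previous lemma, applied to both structures. -/
theorem eventually_fourthDiff_eq_zero
    (hq : 0 < q) (hT : q + 3 ≤ T) (hΛ : IsDifferenceLoading q T β d Λ)
    (hΛ' : IsDifferenceLoading q T β' d Λ')
    (hneg : ∀ k < 0, β k = 0) (hneg' : ∀ k < 0, β' k = 0)
    (hlarge : ∀ k > (q : ℤ) + 1, β k = 0) (hlarge' : ∀ k > (q : ℤ) + 1, β' k = 0)
    (hβ0 : β 0 = 1) (hβ0' : β' 0 = 1) (hβ1 : β 1 ≠ 0) (hβq : β (q + 1) ≠ 0)
    (hβq' : β' (q + 1) ≠ 0)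
    {i j : ℤ} (hi : i ∈ Finset.Icc (1 : ℤ) (q + 1)) (hj : j ∈ Finset.Icc (1 : ℤ) (q + 1))
    (hij : β' j * β i - β' i * β j ≠ 0)
    (H : ∀ᶠ w in 𝓝 (0 : E), ∑ s, g s (Λ s w) = ∑ s, g' s (Λ' s w))
    {s : Finset.Icc (1 - (q : ℤ)) (T : ℤ)} (hs : (s : ℤ) = 1) :
    ∀ᶠ p : ℝ × ℝ × ℝ × ℝ in 𝓝 0, thirdDiff (g s) (p.2.1, 0) (p.2.2.1, 0) (p.2.2.2, 0) (p.1, 0) =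
      thirdDiff (g s) (p.2.1, 0) (p.2.2.1, 0) (p.2.2.2, 0) 0 := by
  have h2 : (2 : ℤ) ∈ Finset.Icc (2 : ℤ) T := by rw [Finset.mem_Icc]; omega
  have h3 : (q + 2 : ℤ) ∈ Finset.Icc (2 : ℤ) T := by rw [Finset.mem_Icc]; omega
  let s₂ : Finset.Icc (1 - (q : ℤ)) (T : ℤ) := ⟨2, by rw [Finset.mem_Icc]; omega⟩
  have hs₂ : (s₂ : ℤ) = 2 := rfl
  have vanish := eventually_thirdDiff_second_eq_zero hT hΛ hΛ' hneg hneg' hlarge hlarge' hβ0 hβq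
    hi hj hij H hs₂
  have vanish' := eventually_thirdDiff_second_eq_zero hT hΛ' hΛ hneg' hneg hlarge' hlarge hβ0' hβq'
    hj hi (by convert hij using 1; ring) (H.mono fun _ h ↦ h.symm) hs₂
  -- only the summands of the first two periods depend on both directions
  have single : ∀ {γ : ℤ → ℝ} {M : Finset.Icc (1 - (q : ℤ)) (T : ℤ) → E →ₗ[ℝ] ℝ × ℝ}
      {f : Finset.Icc (1 - (q : ℤ)) (T : ℤ) → ℝ × ℝ → ℂ}, IsDifferenceLoading q T γ d M →
      (∀ k < 0, γ k = 0) → (∀ k > (q : ℤ) + 1, γ k = 0) → γ 0 = 1 →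
      (∀ᶠ p : E × ℝ × ℝ × ℝ in 𝓝 0, thirdDiff (f s₂) (p.2.1 • (1, 1)) (p.2.2.1 • (1, 0))
        (p.2.2.2 • (1, 0)) (M s₂ p.1) = 0) →
      ∀ᶠ p : E × ℝ × ℝ × ℝ in 𝓝 0, ∑ r, thirdDiff (f r) (p.2.1 • M r (d 2))
        (p.2.2.1 • M r (d (q + 2))) (p.2.2.2 • M r (d (q + 2))) (M r p.1) =
        thirdDiff (f s) (p.2.1 * γ 1, 0) (p.2.2.1 * γ (q + 1), 0) (p.2.2.2 * γ (q + 1), 0)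
          (M s p.1) := by
    intro γ M f hM hγneg hγlarge hγ0 hv
    -- Period `2` meets date `q + 2` at lag `q`. Its loading `γ q` may be zero, which is harmless
    -- since it only multiplies the steps.
    have hcont : Continuous fun p : E × ℝ × ℝ × ℝ ↦ (p.1, p.2.1, p.2.2.1 * γ q, p.2.2.2 * γ q) := by
      fun_prop
    filter_upwards [(hcont.tendsto' 0 0 (by ext <;> simp)).eventually hv] with p hp
    rw [Finset.sum_eq_single s]
    · rw [hM s 2 h2, hM s _ h3, hs, if_neg (by omega), if_neg (by omega),
        show (2 - 1 : ℤ) = 1 by norm_num, show (q + 2 - 1 : ℤ) = q + 1 by ring]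
      simp
    · intro r _ hr
      have hr' : (r : ℤ) ≠ 1 := fun h ↦ hr (Subtype.ext (h.trans hs.symm))
      rcases eq_or_ne r s₂ with rfl | hr₂
      · rw [hM s₂ 2 h2, hM s₂ _ h3, hs₂, if_pos rfl, if_neg (by omega), sub_self, hγ0,
          show (q + 2 - 2 : ℤ) = q by ring]
        simpa using hp
      · have hr₂' : (r : ℤ) ≠ 2 := fun h ↦ hr₂ (Subtype.ext h)
        rcases lt_or_gt_of_ne hr' with h | h
        · rw [hM.eq_zero_right hγlarge h3 (by omega), smul_zero, thirdDiff_zero_mid]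
        · rw [hM.eq_zero_left hγneg h2 (by omega), smul_zero, thirdDiff_zero_left]
    · simp
  have main : ∀ᶠ p : E × ℝ × ℝ × ℝ in 𝓝 0,
      thirdDiff (g s) (p.2.1 * β 1, 0) (p.2.2.1 * β (q + 1), 0) (p.2.2.2 * β (q + 1), 0)
        (Λ s p.1) =
      thirdDiff (g' s) (p.2.1 * β' 1, 0) (p.2.2.1 * β' (q + 1), 0) (p.2.2.2 * β' (q + 1), 0)
        (Λ' s p.1) := by
    filter_upwards [eventually_sum_thirdDiff_eq H (d 2) (d (q + 2)) (d (q + 2)),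
      single hΛ hneg hlarge hβ0 vanish, single hΛ' hneg' hlarge' hβ0' vanish'] with p h h1 h2
    rw [← h1, h, h2]
  set δ := β' j • d (i + s) - β' i • d (j + s) with hδ
  set m := β' j * β i - β' i * β j with hm
  have hΛδ : Λ s δ = (m, 0) := hΛ.minor (by omega) (by omega) hi hj _ _
  have hΛδ' : Λ' s δ = 0 := by
    rw [hδ, hΛ'.minor (by omega) (by omega) hi hj, mul_comm, sub_self]
    rfl
  -- Compare the base points `(p.1 / m) • δ` and `0`: the right side of `main` is the same at both
  -- because `Λ' s δ = 0`.
  have hcont1 : Continuous fun p : ℝ × ℝ × ℝ × ℝ ↦ ((p.1 / m) • δ, p.2.1 / β 1,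
    p.2.2.1 / β (q + 1), p.2.2.2 / β (q + 1)) := by fun_prop
  have hcont2 : Continuous fun p : ℝ × ℝ × ℝ × ℝ ↦ ((0 : E), p.2.1 / β 1,
    p.2.2.1 / β (q + 1), p.2.2.2 / β (q + 1)) := by fun_prop
  filter_upwards [(hcont1.tendsto' 0 0 (by ext <;> simp)).eventually main,
    (hcont2.tendsto' 0 0 (by ext <;> simp)).eventually main] with p h1 h2
  simp only [div_mul_cancel₀ _ hβq, div_mul_cancel₀ _ hβ1, map_smul, hΛδ, hΛδ', smul_zero,
    map_zero, Prod.smul_mk, smul_eq_mul, mul_zero, div_mul_cancel₀ _ hij] at h1 h2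
  rw [h1, h2]

end Identification

/-! ### Differenced lag coefficients and their minors. -/

section Coefficients

variable {q : ℕ}

/-- The lag coefficients `1, a_1, ..., a_q`, extended by zero to all integers. -/
def lagCoeff (a : Fin q → ℝ) (k : ℤ) : ℝ :=
  if k = 0 then 1 else ∑ j : Fin q, if k = (j : ℤ) + 1 then a j else 0

/-- The lag coefficients of the first-differenced moving average. -/
def diffCoeff (a : Fin q → ℝ) (k : ℤ) : ℝ := lagCoeff a k - lagCoeff a (k - 1)

lemma lagCoeff_zero (a : Fin q → ℝ) : lagCoeff a 0 = 1 := by simp [lagCoeff]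

lemma lagCoeff_succ (a : Fin q → ℝ) (j : Fin q) : lagCoeff a ((j : ℤ) + 1) = a j := by
  rw [lagCoeff, if_neg (by omega), Finset.sum_eq_single j]
  · simp
  · intro i _ hi
    rw [if_neg]
    intro h
    exact hi (Fin.ext (by omega))
  · simp

lemma lagCoeff_of_neg (a : Fin q → ℝ) {k : ℤ} (hk : k < 0) : lagCoeff a k = 0 := by
  rw [lagCoeff, if_neg (by omega)]
  exact Finset.sum_eq_zero fun j _ ↦ if_neg (by omega)

lemma lagCoeff_of_gt (a : Fin q → ℝ) {k : ℤ} (hk : (q : ℤ) < k) : lagCoeff a k = 0 := by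
  rw [lagCoeff, if_neg (by omega)]
  exact Finset.sum_eq_zero fun j _ ↦ if_neg (by omega)

lemma diffCoeff_of_neg (a : Fin q → ℝ) {k : ℤ} (hk : k < 0) : diffCoeff a k = 0 := by
  rw [diffCoeff, lagCoeff_of_neg a hk, lagCoeff_of_neg a (by omega), sub_self]

lemma diffCoeff_of_gt (a : Fin q → ℝ) {k : ℤ} (hk : (q : ℤ) + 1 < k) : diffCoeff a k = 0 := by
  rw [diffCoeff, lagCoeff_of_gt a (by omega), lagCoeff_of_gt a (by omega), sub_self]

lemma diffCoeff_zero (a : Fin q → ℝ) : diffCoeff a 0 = 1 := by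
  rw [diffCoeff, lagCoeff_zero, lagCoeff_of_neg a (by omega), sub_zero]

lemma diffCoeff_one (a : Fin q → ℝ) (hq : 0 < q) : diffCoeff a 1 = a ⟨0, hq⟩ - 1 := by
  have := lagCoeff_succ a ⟨0, hq⟩
  rw [diffCoeff, sub_self, lagCoeff_zero, ← this]
  simp

lemma diffCoeff_last (a : Fin q → ℝ) (hq : 0 < q) :
    diffCoeff a (q + 1) = -a ⟨q - 1, Nat.sub_one_lt_of_lt hq⟩ := by
  rw [diffCoeff, lagCoeff_of_gt a (by omega), ← lagCoeff_succ a, zero_sub]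
  congr 2
  push_cast [Nat.cast_sub (show 1 ≤ q from hq)]
  ring

/-- Telescopes from `1` at lag `0` to `0` at lag `q + 1`. This common normalization turns
proportionality into equality. -/
lemma sum_diffCoeff (a : Fin q → ℝ) :
    ∑ k ∈ Finset.range (q + 1), diffCoeff a ((k : ℤ) + 1) = -1 := by
  have := Finset.sum_range_sub (fun k : ℕ ↦ lagCoeff a k) (q + 1)
  push_cast at this
  rw [lagCoeff_zero, lagCoeff_of_gt a (by omega), zero_sub] at this
  simpa [diffCoeff] using this

/-- Different coefficients give linearly independent differenced coefficients. -/
lemma exists_minor_ne_zero {a a' : Fin q → ℝ} (h : a' ≠ a) :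
    ∃ i ∈ Finset.Icc (1 : ℤ) (q + 1), ∃ j ∈ Finset.Icc (1 : ℤ) (q + 1),
      diffCoeff a' j * diffCoeff a i - diffCoeff a' i * diffCoeff a j ≠ 0 := by
  by_contra! hcon
  have heq : ∀ k ∈ Finset.range (q + 1), diffCoeff a' ((k : ℤ) + 1) = diffCoeff a (k + 1) := by
    intro k hk
    rw [Finset.mem_range] at hk
    have hsum : ∑ l ∈ Finset.range (q + 1), (diffCoeff a' ((l : ℤ) + 1) * diffCoeff a (k + 1) -
        diffCoeff a' (k + 1) * diffCoeff a (l + 1)) = 0 := by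
      refine Finset.sum_eq_zero fun l hl ↦ ?_
      rw [Finset.mem_range] at hl
      exact hcon _ (by rw [Finset.mem_Icc]; omega) _ (by rw [Finset.mem_Icc]; omega)
    rw [Finset.sum_sub_distrib, ← Finset.sum_mul, ← Finset.mul_sum, sum_diffCoeff,
      sum_diffCoeff] at hsum
    linarith
  have hlag : ∀ k : ℕ, k ≤ q + 1 → lagCoeff a' k = lagCoeff a k := by
    intro k
    induction k with
    | zero => intro _; simp [lagCoeff_zero]
    | succ k ih =>
      intro hk
      have h1 := heq k (Finset.mem_range.2 (by omega))
      have h2 := ih (by omega)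
      simp only [diffCoeff, add_sub_cancel_right] at h1
      push_cast
      linarith
  refine h (funext fun j ↦ ?_)
  rw [← lagCoeff_succ a' j, ← lagCoeff_succ a j]
  exact_mod_cast hlag (j + 1) (by omega)

end Coefficients

/-! ### Linear combinations of earnings in terms of the shocks. -/

section Loadings

variable {q : ℕ}

/-- The coefficients of the shocks of period `s` in a linear combination of the earnings. -/
noncomputable def loading (T : ℕ) (a : Fin q → ℝ) (s : ℤ) : (Fin T → ℝ) →ₗ[ℝ] ℝ × ℝ :=
  (∑ t : Fin T, lagCoeff a ((t : ℤ) + 1 - s) • LinearMap.proj t).prod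
    (∑ t : Fin T, (if s ≤ (t : ℤ) + 1 then (1 : ℝ) else 0) • LinearMap.proj t)

lemma loading_apply (T : ℕ) (a : Fin q → ℝ) (s : ℤ) (c : Fin T → ℝ) : loading T a s c =
    (∑ t : Fin T, lagCoeff a ((t : ℤ) + 1 - s) * c t,
      ∑ t : Fin T, (if s ≤ (t : ℤ) + 1 then (1 : ℝ) else 0) * c t) := by
  simp only [loading, LinearMap.prod_apply, Function.prod, LinearMap.sum_apply,
    LinearMap.smul_apply, LinearMap.proj_apply, smul_eq_mul]

/-- The linear combination that picks the first difference of the earnings of period `i`. -/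
def firstDifference (T : ℕ) (i : ℤ) (t : Fin T) : ℝ :=
  (if (t : ℤ) + 1 = i then 1 else 0) - (if (t : ℤ) + 1 = i - 1 then 1 else 0)

lemma sum_mul_firstDifference {T : ℕ} {i : ℤ} (hi : i ∈ Finset.Icc (2 : ℤ) T) (f : ℤ → ℝ) :
    ∑ t : Fin T, f ((t : ℤ) + 1) * firstDifference T i t = f i - f (i - 1) := by
  have key : ∀ i : ℤ, 1 ≤ i → i ≤ T →
      ∑ t : Fin T, f ((t : ℤ) + 1) * (if (t : ℤ) + 1 = i then 1 else 0) = f i := by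
    intro i h1 hT
    rw [Finset.sum_eq_single ⟨(i - 1).toNat, by omega⟩]
    · have : (((i - 1).toNat : ℕ) : ℤ) + 1 = i := by omega
      simp only [this, if_true, mul_one]
    · intro t _ ht
      rw [if_neg, mul_zero]
      intro h
      exact ht (Fin.ext (by simp only; omega))
    · simp
  rw [Finset.mem_Icc] at hi
  simp only [firstDifference, mul_sub, Finset.sum_sub_distrib]
  rw [key i (by omega) hi.2, key (i - 1) (by omega) (by omega)]

lemma isDifferenceLoading_loading (T : ℕ) (a : Fin q → ℝ) :
    IsDifferenceLoading q T (diffCoeff a) (firstDifference T)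
      (fun s : Finset.Icc (1 - (q : ℤ)) (T : ℤ) ↦ loading T a s) := by
  intro s i hi
  rw [loading_apply, sum_mul_firstDifference hi (fun t ↦ lagCoeff a (t - s)),
    sum_mul_firstDifference hi (fun t ↦ if (s : ℤ) ≤ t then (1 : ℝ) else 0), diffCoeff,
    show i - 1 - (s : ℤ) = i - s - 1 by ring]
  congr 1
  rcases lt_trichotomy i s with h | h | h
  · rw [if_neg (by omega), if_neg (by omega), if_neg (by omega), sub_self]
  · rw [if_pos (by omega), if_neg (by omega), if_pos h, sub_zero]
  · rw [if_pos (by omega), if_pos (by omega), if_neg (by omega), sub_self]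

variable {Ω : Type*}

/-- Pre-sample periods have second component `0` in `shocks`, so the sum may start at `1 - q`. -/
lemma permanent_eq_sum {T : ℕ} (ξ η : ℤ → Ω → ℝ) {t : ℤ} (ht : t ≤ T) (ω : Ω) :
    permanent η t ω = ∑ s : Finset.Icc (1 - (q : ℤ)) (T : ℤ),
      (if (s : ℤ) ≤ t then (1 : ℝ) else 0) * (shocks ξ η s ω).2 := by
  rw [Finset.sum_coe_sort (Finset.Icc (1 - (q : ℤ)) (T : ℤ))
    (fun s ↦ (if s ≤ t then (1 : ℝ) else 0) * (shocks ξ η s ω).2), permanent]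
  refine Finset.sum_subset_zero_on_sdiff ?_ ?_ ?_
  · intro s hs
    rw [Finset.mem_Icc] at hs ⊢
    omega
  · intro s hs
    rw [Finset.mem_sdiff, Finset.mem_Icc, Finset.mem_Icc] at hs
    by_cases h : s ≤ t
    · simp only [shocks]
      rw [if_neg (show ¬ 1 ≤ s by omega), mul_zero]
    · rw [if_neg h, zero_mul]
  · intro s hs
    rw [Finset.mem_Icc] at hs
    simp [shocks, hs.1, hs.2]

lemma transitory_eq_sum {T : ℕ} (a : Fin q → ℝ) (ξ η : ℤ → Ω → ℝ) {t : ℤ} (h1 : 1 ≤ t)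
    (ht : t ≤ T) (ω : Ω) :
    transitory a ξ t ω = ∑ s : Finset.Icc (1 - (q : ℤ)) (T : ℤ),
      lagCoeff a (t - s) * (shocks ξ η s ω).1 := by
  rw [Finset.sum_coe_sort (Finset.Icc (1 - (q : ℤ)) (T : ℤ))
    (fun s ↦ lagCoeff a (t - s) * (shocks ξ η s ω).1)]
  have hsplit : ∀ s, lagCoeff a (t - s) * (shocks ξ η s ω).1 = (if s = t then ξ s ω else 0) +
      ∑ j : Fin q, if s = t - ((j : ℤ) + 1) then a j * ξ s ω else 0 := by
    intro s
    by_cases h : s = t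
    · rw [h, sub_self, lagCoeff_zero, if_pos rfl, Finset.sum_eq_zero, add_zero, one_mul]
      · rfl
      · exact fun j _ ↦ if_neg (by omega)
    · rw [if_neg h, zero_add, lagCoeff, if_neg (by omega), Finset.sum_mul]
      refine Finset.sum_congr rfl fun j _ ↦ ?_
      by_cases hj : s = t - ((j : ℤ) + 1)
      · rw [if_pos hj, if_pos (by omega)]
        rfl
      · rw [if_neg hj, if_neg (by omega), zero_mul]
  simp only [hsplit, Finset.sum_add_distrib]
  rw [Finset.sum_comm, Finset.sum_ite_eq', if_pos (by rw [Finset.mem_Icc]; omega), transitory]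
  congr 1
  refine Finset.sum_congr rfl fun j _ ↦ ?_
  rw [Finset.sum_ite_eq', if_pos (by rw [Finset.mem_Icc]; omega)]

lemma sum_mul_earnings (T : ℕ) (a : Fin q → ℝ) (ξ η : ℤ → Ω → ℝ) (c : Fin T → ℝ) (ω : Ω) :
    ∑ t, c t * earnings T a ξ η ω t = ∑ s : Finset.Icc (1 - (q : ℤ)) (T : ℤ),
      ((loading T a s c).1 * (shocks ξ η s ω).1 + (loading T a s c).2 * (shocks ξ η s ω).2) := by
  have h : ∀ t : Fin T, c t * earnings T a ξ η ω t = ∑ s : Finset.Icc (1 - (q : ℤ)) (T : ℤ),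
      (lagCoeff a ((t : ℤ) + 1 - s) * c t * (shocks ξ η s ω).1 +
        (if (s : ℤ) ≤ (t : ℤ) + 1 then (1 : ℝ) else 0) * c t * (shocks ξ η s ω).2) := by
    intro t
    rw [earnings, permanent_eq_sum (q := q) ξ η (T := T) (by omega),
      transitory_eq_sum a ξ η (T := T) (by omega) (by omega), ← Finset.sum_add_distrib,
      Finset.mul_sum]
    refine Finset.sum_congr rfl fun s _ ↦ ?_
    ring
  simp only [h]
  rw [Finset.sum_comm]
  refine Finset.sum_congr rfl fun s _ ↦ ?_
  rw [loading_apply, Finset.sum_add_distrib, Finset.sum_mul, Finset.sum_mul]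

end Loadings

/-! ### Factorization of the characteristic function of the earnings. -/

section Factorization

variable {Ω : Type*} [MeasurableSpace Ω] {P : Measure Ω} {q T : ℕ} {ξ η : ℤ → Ω → ℝ}

/-- The joint characteristic function of the shocks of period `s`. -/
noncomputable def shockCharFun (P : Measure Ω) (ξ η : ℤ → Ω → ℝ) (s : ℤ) (p : ℝ × ℝ) : ℂ :=
  ∫ ω, Complex.exp ((p.1 * (shocks ξ η s ω).1 + p.2 * (shocks ξ η s ω).2 : ℝ) * Complex.I) ∂P

lemma ShockAssumption.measurable_shocks (h : ShockAssumption P q T ξ η)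
    (s : Finset.Icc (1 - (q : ℤ)) (T : ℤ)) : Measurable (shocks ξ η s) := by
  refine (h.measurable_transitory s s.2).prodMk ?_
  by_cases hs : 1 ≤ (s : ℤ)
  · simpa only [hs, if_true] using h.measurable_permanent s
      (by rw [Finset.mem_Icc]; exact ⟨hs, (Finset.mem_Icc.1 s.2).2⟩)
  · simp only [hs, if_false, measurable_const]

lemma ShockAssumption.measurable_earnings (h : ShockAssumption P q T ξ η) (a : Fin q → ℝ) :
    Measurable (earnings T a ξ η) := by
  refine measurable_pi_lambda _ fun t ↦ ?_
  have hs := h.measurable_shocks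
  have : (fun ω ↦ earnings T a ξ η ω t) = fun ω ↦ (∑ s : Finset.Icc (1 - (q : ℤ)) (T : ℤ),
      (if (s : ℤ) ≤ (t : ℤ) + 1 then (1 : ℝ) else 0) * (shocks ξ η s ω).2) +
      ∑ s : Finset.Icc (1 - (q : ℤ)) (T : ℤ),
        lagCoeff a ((t : ℤ) + 1 - s) * (shocks ξ η s ω).1 := by
    funext ω
    rw [earnings, permanent_eq_sum (q := q) ξ η (T := T) (by omega),
      transitory_eq_sum a ξ η (T := T) (by omega) (by omega)]
  rw [this]
  exact (Finset.measurable_sum _ fun s _ ↦ (hs s).snd.const_mul _).add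
    (Finset.measurable_sum _ fun s _ ↦ (hs s).fst.const_mul _)

lemma ShockAssumption.continuous_shockCharFun [IsProbabilityMeasure P] (h : ShockAssumption P q T ξ η)
    (s : Finset.Icc (1 - (q : ℤ)) (T : ℤ)) : Continuous (shockCharFun P ξ η s) := by
  have hs := h.measurable_shocks s
  unfold shockCharFun
  generalize shocks ξ η s = X at hs ⊢
  refine continuous_of_dominated (bound := fun _ ↦ 1) (fun p ↦ ?_) (fun p ↦ ae_of_all _ fun ω ↦ ?_)
    (integrable_const _) (ae_of_all _ fun ω ↦ by fun_prop)
  · exact Measurable.aestronglyMeasurable (by fun_prop)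
  · rw [Complex.norm_exp_ofReal_mul_I]

lemma shockCharFun_zero [IsProbabilityMeasure P] (s : ℤ) : shockCharFun P ξ η s 0 = 1 := by
  simp [shockCharFun]

lemma ShockAssumption.shockCharFun_left (h : ShockAssumption P q T ξ η)
    (s : Finset.Icc (1 - (q : ℤ)) (T : ℤ)) (x : ℝ) :
    shockCharFun P ξ η s (x, 0) = charFun (P.map (ξ s)) x := by
  rw [charFun_apply_real, integral_map (h.measurable_transitory s s.2).aemeasurable
    (by fun_prop)]
  simp [shockCharFun, shocks]

lemma ShockAssumption.integral_exp_earnings (h : ShockAssumption P q T ξ η) (a : Fin q → ℝ)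
    (c : Fin T → ℝ) :
    ∫ y, Complex.exp ((∑ t, c t * y t : ℝ) * Complex.I) ∂(P.map (earnings T a ξ η)) =
      ∏ s : Finset.Icc (1 - (q : ℤ)) (T : ℤ), shockCharFun P ξ η s (loading T a s c) := by
  rw [integral_map (h.measurable_earnings a).aemeasurable
    (Measurable.aestronglyMeasurable (by fun_prop))]
  simp only [sum_mul_earnings]
  push_cast
  simp only [Finset.sum_mul, Complex.exp_sum]
  have := h.indep.integral_fun_prod_comp
    (f := fun (s : Finset.Icc (1 - (q : ℤ)) (T : ℤ)) p ↦ Complex.exp (((loading T a s c).1 * p.1 + (loading T a s c).2 * p.2 : ℝ) *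
      Complex.I))
    (fun s ↦ (h.measurable_shocks s).aemeasurable)
    (fun s ↦ Measurable.aestronglyMeasurable (by fun_prop))
  push_cast at this
  rw [this]
  refine Finset.prod_congr rfl fun s _ ↦ ?_
  simp [shockCharFun]

end Factorization

/-- An identity of products of continuous functions yields an identity of sums of logarithms
near a point where all factors are equal to `1`. -/
lemma eventually_sum_log_eq {E ι : Type*} [TopologicalSpace E] [Fintype ι] {x : E}
    {f f' : ι → E → ℂ} (hf : ∀ s, ContinuousAt (f s) x) (hf' : ∀ s, ContinuousAt (f' s) x)
    (h1 : ∀ s, f s x = 1) (h1' : ∀ s, f' s x = 1) (h : ∀ w, ∏ s, f s w = ∏ s, f' s w) :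
    ∀ᶠ w in 𝓝 x, ∑ s, Complex.log (f s w) = ∑ s, Complex.log (f' s w) := by
  have hne : ∀ᶠ w in 𝓝 x, ∀ s, f s w ≠ 0 :=
    eventually_all.2 fun s ↦ (hf s).eventually_ne (by simp [h1])
  have hne' : ∀ᶠ w in 𝓝 x, ∀ s, f' s w ≠ 0 :=
    eventually_all.2 fun s ↦ (hf' s).eventually_ne (by simp [h1'])
  have hlog : ∀ {u : E → ℂ}, ContinuousAt u x → u x = 1 →
      ContinuousAt (fun w ↦ Complex.log (u w)) x := fun hu hux ↦
    hu.clog (by simp [hux])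
  have hD : ContinuousAt
      (fun w ↦ ∑ s, Complex.log (f s w) - ∑ s, Complex.log (f' s w)) x :=
    (tendsto_finsetSum _ fun s _ ↦ hlog (hf s) (h1 s)).sub
      (tendsto_finsetSum _ fun s _ ↦ hlog (hf' s) (h1' s))
  -- Both sums of logarithms exponentiate to the same product, so they differ by a multiple of
  -- `2πi`; continuity and the value `0` at `x` single out the multiple zero.
  have him : ∀ᶠ w in 𝓝 x,
      |(∑ s, Complex.log (f s w) - ∑ s, Complex.log (f' s w)).im| < Real.pi := by
    refine (Complex.continuous_im.abs.continuousAt.comp hD).eventually_lt continuousAt_const ?_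
    simp [h1, h1', Real.pi_pos]
  filter_upwards [hne, hne', him] with w hw hw' hi
  rw [abs_lt] at hi
  rw [← sub_eq_zero, ← Complex.log_exp hi.1 hi.2.le, Complex.exp_sub, Complex.exp_sum,
    Complex.exp_sum]
  simp only [Complex.exp_log (hw _), Complex.exp_log (hw' _), h]
  rw [div_self (Finset.prod_ne_zero_iff.2 fun s _ ↦ hw' s), Complex.log_one]


end EarningsDynamics

/-! ### Identification of the coefficients. -/

open EarningsDynamics

theorem theorem1 {q T : ℕ} (hq : 0 < q) (hT : q + 3 ≤ T)
    {Ω Ω' : Type*} [MeasurableSpace Ω] [MeasurableSpace Ω']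
    (P : Measure Ω) [IsProbabilityMeasure P] (P' : Measure Ω') [IsProbabilityMeasure P']
    (a : Fin q → ℝ) (ξ η : ℤ → Ω → ℝ)
    (a' : Fin q → ℝ) (ξ' η' : ℤ → Ω' → ℝ)
    (h : EarningsDynamics.ShockAssumption P q T ξ η)
    (h' : EarningsDynamics.ShockAssumption P' q T ξ' η')
    (ha_first : a ⟨0, hq⟩ ∉ ({0, 1} : Set ℝ))
    (ha_last : a ⟨q - 1, Nat.sub_one_lt_of_lt hq⟩ ∉ ({0, 1} : Set ℝ))
    (ha'_last : a' ⟨q - 1, Nat.sub_one_lt_of_lt hq⟩ ≠ 0)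
    (hξ : ¬ HasGaussianLaw (ξ 1) P)
    (hobs : P.map (EarningsDynamics.earnings T a ξ η) =
      P'.map (EarningsDynamics.earnings T a' ξ' η')) :
    a' = a := by
  by_contra hne
  obtain ⟨i, hi, j, hj, hij⟩ := exists_minor_ne_zero hne
  simp only [Set.mem_insert_iff, Set.mem_singleton_iff, not_or] at ha_first ha_last
  have hcont : ∀ (b : Fin q → ℝ) (s : ℤ), Continuous (loading T b s) := fun b s ↦
    LinearMap.continuous_of_finiteDimensional _
  have H := eventually_sum_log_eq (x := (0 : Fin T → ℝ))
    (f := fun (s : Finset.Icc (1 - (q : ℤ)) (T : ℤ)) w ↦ shockCharFun P ξ η s (loading T a s w))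
    (f' := fun s w ↦ shockCharFun P' ξ' η' s (loading T a' s w))
    (fun s ↦ ((h.continuous_shockCharFun s).comp (hcont a s)).continuousAt)
    (fun s ↦ ((h'.continuous_shockCharFun s).comp (hcont a' s)).continuousAt)
    (fun s ↦ by rw [map_zero, shockCharFun_zero]) (fun s ↦ by rw [map_zero, shockCharFun_zero])
    (fun w ↦ by rw [← h.integral_exp_earnings, ← h'.integral_exp_earnings, hobs])
  let s₁ : Finset.Icc (1 - (q : ℤ)) (T : ℤ) := ⟨1, by rw [Finset.mem_Icc]; omega⟩
  have key := eventually_fourthDiff_eq_zero hq hT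
    (isDifferenceLoading_loading T a) (isDifferenceLoading_loading T a')
    (fun _ ↦ diffCoeff_of_neg a) (fun _ ↦ diffCoeff_of_neg a')
    (fun _ ↦ diffCoeff_of_gt a) (fun _ ↦ diffCoeff_of_gt a')
    (diffCoeff_zero a) (diffCoeff_zero a')
    (by rw [diffCoeff_one a hq]; exact sub_ne_zero.2 ha_first.2)
    (by rw [diffCoeff_last a hq]; exact neg_ne_zero.2 ha_last.1)
    (by rw [diffCoeff_last a' hq]; exact neg_ne_zero.2 ha'_last)
    hi hj hij
    (g := fun s p ↦ Complex.log (shockCharFun P ξ η s p))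
    (g' := fun s p ↦ Complex.log (shockCharFun P' ξ' η' s p)) H (s := s₁) rfl
  have hmeas : Measurable (ξ 1) := h.measurable_transitory s₁ s₁.2
  have : IsProbabilityMeasure (P.map (ξ 1)) :=
    Measure.isProbabilityMeasure_map hmeas.aemeasurable
  -- Gaussian laws include the Dirac masses here, so `hξ` excludes the normal and the constant case
  -- at once.
  refine hξ ⟨isGaussian_of_fourthDiff_log_charFun ?_⟩
  filter_upwards [key] with p hp
  have hleft : ∀ x, charFun (P.map (ξ 1)) x = shockCharFun P ξ η s₁ (x, 0) := fun x ↦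
    (h.shockCharFun_left s₁ x).symm
  rw [← sub_eq_zero] at hp
  simpa only [thirdDiff_eq, fwdDiff, hleft, Prod.mk_add_mk, Prod.fst_zero, add_zero, zero_add,
    Prod.mk_zero_zero] using hp
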